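/- Let $n\ge 1$ and let $G=\langle g\rangle\le S_n$ be the cyclic permutation group generated by a permutation $g$ which is a product of two disjoint cycles of lengths $\ell_1,\ell_2\ge 1$ (cycles of length $1$ are allowed) and which fixes all remaining points of $\{1,\dots,n\}$, if there are any. Let $P(G)\subseteq \mathrm{Mat}_n(\mathbb R)$ be the permutation polytope of $G$, i.e. the convex hull of the permutation matrices of the elements of $G$, and put $q:=\gcd(\ell_1,\ell_2)$. Then for every integer $k\ge 0$ the set $kP(G)\cap \mathrm{Mat}_n(\mathbb Z)$ is finite, and, as formal power series in $t$, \[ \sum_{k=0}^{\infty}\bigl|kP(G)\cap \mathrm{Mat}_n(\mathbb Z)\bigr|\,t^k =\frac{\left(\sum_{i=0}^{\min\left(\frac{\ell_1}{q}-1,\frac{\ell_2}{q}-1\right)}\binom{\frac{\ell_1}{q}-1}{i}\binom{\frac{\ell_2}{q}-1}{i}t^i\right)^{q}}{(1-t)^{\ell_1+\ell_2-q}} . \] -/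

import Mathlib

open scoped Pointwise PowerSeries

/-- The permutation polytope `P(G)`: the convex hull of the permutation matrices of the elements
of a permutation group `G ≤ Sₙ`, inside the space of real `n × n` matrices. -/
def permutationPolytope {n : ℕ} (G : Subgroup (Equiv.Perm (Fin n))) :
    Set (Matrix (Fin n) (Fin n) ℝ) :=
  convexHull ℝ ((fun σ : Equiv.Perm (Fin n) => σ.permMatrix ℝ) '' (G : Set (Equiv.Perm (Fin n))))

/-- The lattice `Matₙ(ℤ)` of integral matrices inside the real `n × n` matrices. -/
def integralMatrices (n : ℕ) : Set (Matrix (Fin n) (Fin n) ℝ) :=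
  Set.range fun Z : Matrix (Fin n) (Fin n) ℤ => Z.map (fun z => (z : ℝ))

/-- The lattice points of the `k`-th dilate of `P`. -/
def dilateLatticePoints {n : ℕ} (P : Set (Matrix (Fin n) (Fin n) ℝ)) (k : ℕ) :
    Set (Matrix (Fin n) (Fin n) ℝ) :=
  ((k : ℝ) • P) ∩ integralMatrices n

/-- The Ehrhart series `∑ₖ |kP ∩ Matₙ(ℤ)| tᵏ` of `P`, as a formal power series. -/
noncomputable def ehrhartSeries {n : ℕ} (P : Set (Matrix (Fin n) (Fin n) ℝ)) : ℚ⟦X⟧ :=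
  PowerSeries.mk fun k => ((dilateLatticePoints P k).ncard : ℚ)

/-! Every linear relation shared by the matrices of all `g ^ m` passes to the dilates of the
polytope. Commutation with `g` makes a point of `kP(G)` circulant along each cycle, hence determined
by one row per cycle. Sort the positions in these two rows by residue mod `q`. Each `g ^ m` marks
one position per row, both in the class of `m`, so in every class the two partial row sums agree,
and each whole row sums to `k`. Conversely, by the Chinese remainder theorem any two positions in
the same class are marked by a common `g ^ m`, so a balanced family of natural numbers is a sum of
`k` vertices. Lattice points thus correspond to balanced families (`bijOn_cycleEntries`).

With `ℓ₁ = q(A+1)` and `ℓ₂ = q(B+1)`, stars and bars gives each class the series `∑ₛ (A+s choose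
A)(B+s choose B) tˢ`, that of a product of two simplices. The Ehrhart series is its `q`-th power,
and `mk_choose_mul_choose_mul_one_sub_X_pow` gives the rational form. -/

/-! ### The series of a product of two simplices -/

/-- Coefficient form of the recursion in `A` satisfied by the numerators `∑ᵢ (A choose i)(B choose
i) tⁱ`. -/
theorem mul_choose_mul_choose_succ_step (A B i : ℕ) :
    ((A : ℚ) + 1) * ((A + 1).choose (i + 1) * B.choose (i + 1)) =
      (A + 2 + i) * (A.choose (i + 1) * B.choose (i + 1)) + (B - i) * (A.choose i * B.choose i) := by
  have h₁ : ((B.choose (i + 1) : ℚ)) * (i + 1) = B.choose i * (B - i) := by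
    rcases le_or_gt i B with h | h
    · have := Nat.choose_succ_right_eq B i
      rw [← Nat.cast_sub h]
      exact_mod_cast this
    · simp [Nat.choose_eq_zero_of_lt h, Nat.choose_eq_zero_of_lt (Nat.lt_succ_of_lt h)]
  have h₂ : ((A : ℚ) + 1) * A.choose i = (A + 1).choose (i + 1) * (i + 1) := by
    exact_mod_cast Nat.add_one_mul_choose_eq A i
  have h₃ : ((A + 1).choose (i + 1) : ℚ) = A.choose i + A.choose (i + 1) := by
    exact_mod_cast Nat.choose_succ_succ A i
  linear_combination (A.choose i : ℚ) * h₁ + (B.choose (i + 1) : ℚ) * h₂ +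
    ((A : ℚ) + 2 + i) * (B.choose (i + 1) : ℚ) * h₃

/-- `∑ₛ (s+A choose A)(s+B choose B) tˢ` has numerator `∑ᵢ (A choose i)(B choose i) tⁱ` over
`(1 - t) ^ (A + B + 1)`. -/
theorem mk_choose_mul_choose_mul_one_sub_X_pow (A B : ℕ) :
    (PowerSeries.mk fun s => ((A + s).choose A * (B + s).choose B : ℚ)) *
        (1 - PowerSeries.X) ^ (A + B + 1) =
      PowerSeries.mk fun i => (A.choose i * B.choose i : ℚ) := by
  induction A with
  | zero =>
    have h : (PowerSeries.mk fun s => ((0 + s).choose 0 * (B + s).choose B : ℚ)) =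
        PowerSeries.mk 1 ^ (B + 1) := by
      rw [PowerSeries.mk_one_pow_eq_mk_choose_add]; simp
    rw [h, zero_add, ← mul_pow, PowerSeries.mk_one_mul_one_sub_eq_one, one_pow]
    ext i
    cases i <;> simp [PowerSeries.coeff_one]
  | succ A ih =>
    set F := PowerSeries.mk fun s => ((A + s).choose A * (B + s).choose B : ℚ) with hF
    set H := PowerSeries.mk fun i => (A.choose i * B.choose i : ℚ) with hH
    -- Opaque names keep `map_add` from splitting the constants `C α` and `C β`.
    obtain ⟨α, hα⟩ : ∃ α : ℚ, α = A + 1 := ⟨_, rfl⟩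
    obtain ⟨β, hβ⟩ : ∃ β : ℚ, β = A + B + 1 := ⟨_, rfl⟩
    -- Passing from `A` to `A + 1` applies the Euler operator `X d/dX + α`, up to the factor `α`.
    have hrec : PowerSeries.C α *
        (PowerSeries.mk fun s => ((A + 1 + s).choose (A + 1) * (B + s).choose B : ℚ)) =
        PowerSeries.X * PowerSeries.derivative ℚ F + PowerSeries.C α * F := by
      ext s
      have h : ((A : ℚ) + 1) * (A + 1 + s).choose (A + 1) = (A + 1 + s) * (A + s).choose A := by
        have := Nat.add_one_mul_choose_eq (A + s) A
        rw [show A + 1 + s = A + s + 1 by ring]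
        have h' : ((A + s + 1 : ℕ) : ℚ) * (A + s).choose A =
          (A + s + 1).choose (A + 1) * (A + 1 : ℕ) := by exact_mod_cast this
        push_cast at h'
        linear_combination -h'
      cases s with
      | zero => simp [hF]
      | succ s =>
        simp only [map_add, PowerSeries.coeff_C_mul, PowerSeries.coeff_succ_X_mul,
          PowerSeries.coeff_derivative, PowerSeries.coeff_mk, hF]
        rw [hα]
        push_cast at h ⊢
        linear_combination ((B + (s + 1)).choose B : ℚ) * h
    -- Differentiating the induction hypothesis expresses `F'` through `F` and `H'`.
    have hd := congrArg (PowerSeries.derivative ℚ) ih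
    rw [Derivation.leibniz, PowerSeries.derivative_pow] at hd
    simp only [smul_eq_mul, map_sub, PowerSeries.derivative_one, PowerSeries.derivative_X,
      add_tsub_cancel_right] at hd
    have hfin : PowerSeries.C α *
        PowerSeries.mk (fun i => ((A + 1).choose i * B.choose i : ℚ)) =
        (1 - PowerSeries.X) * (PowerSeries.X * PowerSeries.derivative ℚ H +
          PowerSeries.C α * H) +
          PowerSeries.C β * (PowerSeries.X * H) := by
      ext i
      rw [sub_mul, one_mul, mul_add PowerSeries.X]
      cases i with
      | zero => simp [hH]
      | succ i =>
        have h := mul_choose_mul_choose_succ_step A B i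
        cases i with
        | zero =>
          simp only [map_add, map_sub, PowerSeries.coeff_C_mul, PowerSeries.coeff_succ_X_mul,
            PowerSeries.coeff_derivative, PowerSeries.coeff_mk, hH,
            PowerSeries.coeff_zero_X_mul]
          rw [hα, hβ]
          push_cast at h ⊢
          linear_combination h
        | succ i =>
          simp only [map_add, map_sub, PowerSeries.coeff_C_mul, PowerSeries.coeff_succ_X_mul,
            PowerSeries.coeff_derivative, PowerSeries.coeff_mk, hH]
          rw [hα, hβ]
          push_cast at h ⊢
          linear_combination h
    have hC : PowerSeries.C α ≠ 0 := by
      rw [Ne, map_eq_zero_iff _ PowerSeries.C_injective, hα]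
      positivity
    apply mul_left_cancel₀ hC
    rw [hfin, ← mul_assoc, hrec]
    have hcast : ((A + B + 1 : ℕ) : ℚ⟦X⟧) = PowerSeries.C β := by
      simp [hβ]
    rw [hcast] at hd
    rw [← ih] at hd ⊢
    rw [← hd]
    ring

/-! ### Counting balanced families -/

/-- Families of pairs of vectors of natural numbers with equal coordinate sums and total `k`. -/
def balancedPairs (q a b k : ℕ) : Finset (Fin q → (Fin a → ℕ) × (Fin b → ℕ)) :=
  (Finset.piAntidiag Finset.univ k).biUnion fun l : Fin q → ℕ =>
    Fintype.piFinset fun r =>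
      Finset.piAntidiag Finset.univ (l r) ×ˢ Finset.piAntidiag Finset.univ (l r)

theorem mem_balancedPairs {q a b k : ℕ} {p : Fin q → (Fin a → ℕ) × (Fin b → ℕ)} :
    p ∈ balancedPairs q a b k ↔
      (∀ r, ∑ i, (p r).1 i = ∑ j, (p r).2 j) ∧ ∑ r, ∑ i, (p r).1 i = k := by
  simp only [balancedPairs, Finset.mem_biUnion, Finset.mem_piAntidiag, Fintype.mem_piFinset,
    Finset.mem_product, Finset.mem_univ, implies_true, and_true]
  constructor
  · rintro ⟨l, hl, h⟩
    exact ⟨fun r => (h r).1.trans (h r).2.symm, by simp only [(h _).1, hl]⟩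
  · rintro ⟨h, hk⟩
    exact ⟨fun r => ∑ i, (p r).1 i, hk, fun r => ⟨rfl, (h r).symm⟩⟩

theorem coeff_prod_univ_eq_sum_piAntidiag {ι R : Type*} [Fintype ι] [DecidableEq ι]
    [CommSemiring R] (f : ι → R⟦X⟧) (k : ℕ) :
    PowerSeries.coeff k (∏ r, f r) =
      ∑ l ∈ Finset.piAntidiag Finset.univ k, ∏ r, PowerSeries.coeff (l r) (f r) := by
  rw [PowerSeries.coeff_prod]
  refine Finset.sum_bij (fun l _ => ⇑l) ?_ ?_ ?_ ?_
  · intro l hl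
    simpa using hl
  · intro l _ l' _ h
    exact DFunLike.coe_injective h
  · intro l hl
    exact ⟨Finsupp.equivFunOnFinite.symm l, by simpa using hl, by simp⟩
  · simp

/-- Stars and bars, by reading a coefficient of `(1 + X + X² + ⋯) ^ (A + 1)` in two ways. -/
theorem card_piAntidiag_univ_fin_succ (A s : ℕ) :
    (Finset.piAntidiag (Finset.univ : Finset (Fin (A + 1))) s).card = (A + s).choose A := by
  have h := coeff_prod_univ_eq_sum_piAntidiag (fun _ : Fin (A + 1) => (PowerSeries.mk 1 : ℚ⟦X⟧)) s
  rw [Finset.prod_const, Finset.card_univ, Fintype.card_fin,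
    PowerSeries.mk_one_pow_eq_mk_choose_add] at h
  simp only [PowerSeries.coeff_mk, Pi.one_apply, Finset.prod_const_one, Finset.sum_const,
    nsmul_eq_mul, mul_one] at h
  exact_mod_cast h.symm

theorem card_balancedPairs (q A B k : ℕ) :
    ((balancedPairs q (A + 1) (B + 1) k).card : ℚ) = PowerSeries.coeff k
      ((PowerSeries.mk fun s => ((A + s).choose A * (B + s).choose B : ℚ)) ^ q) := by
  have h := coeff_prod_univ_eq_sum_piAntidiag (fun _ : Fin q =>
    (PowerSeries.mk fun s => ((A + s).choose A * (B + s).choose B : ℚ))) k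
  rw [Finset.prod_const, Finset.card_univ, Fintype.card_fin] at h
  rw [h, balancedPairs, Finset.card_biUnion]
  · simp [Fintype.card_piFinset, Finset.card_product, card_piAntidiag_univ_fin_succ]
  · intro l _ l' _ hne
    refine Finset.disjoint_left.2 ?_
    intro p hp hp'
    apply hne
    funext r
    rw [Fintype.mem_piFinset] at hp hp'
    have h₁ := (Finset.mem_piAntidiag.1 (Finset.mem_product.1 (hp r)).1).1
    have h₂ := (Finset.mem_piAntidiag.1 (Finset.mem_product.1 (hp' r)).1).1
    exact h₁.symm.trans h₂

/-! ### Residues and the Chinese remainder theorem -/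

theorem modEq_add_mul_iff {q a : ℕ} (m : ℕ) (r : Fin q) (i : Fin a) :
    m ≡ r + q * i [MOD q * a] ↔ m % q = r ∧ m / q % a = i := by
  have hlt : (r : ℕ) + q * i < q * a := by
    have := r.2
    have h : q * ((i : ℕ) + 1) ≤ q * a := Nat.mul_le_mul_left _ i.2
    rw [mul_add, mul_one] at h
    omega
  have hq : 0 < q := r.pos
  rw [Nat.ModEq, Nat.mod_eq_of_lt hlt, Nat.mod_mul]
  constructor
  · intro h
    have h₁ := congrArg (· % q) h
    have h₂ := congrArg (· / q) h
    simp only [Nat.add_mul_mod_self_left, Nat.mod_mod, Nat.mod_eq_of_lt r.2] at h₁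
    simp only [Nat.add_mul_div_left _ _ hq, Nat.div_eq_of_lt r.2,
      Nat.div_eq_of_lt (Nat.mod_lt _ hq), zero_add] at h₂
    exact ⟨h₁, h₂⟩
  · rintro ⟨h₁, h₂⟩
    rw [h₁, h₂]

/-- The moduli are not coprime in general, but both targets reduce to `r` modulo their gcd `q`, so
they are compatible. -/
theorem exists_modEq_add_mul {q a b : ℕ} (hab : Nat.gcd (q * a) (q * b) = q)
    (r : Fin q) (i : Fin a) (j : Fin b) :
    ∃ m : ℕ, m ≡ r + q * i [MOD q * a] ∧ m ≡ r + q * j [MOD q * b] := by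
  have h : (r : ℕ) + q * i ≡ r + q * j [MOD Nat.gcd (q * a) (q * b)] := by
    rw [hab]
    simp [Nat.ModEq]
  exact ⟨_, (Nat.chineseRemainder' h).2⟩

/-! ### Linear relations on dilates of the polytope -/

section PermMatrix

variable {n : ℕ}

theorem permMatrix_apply_eq_ite (σ : Equiv.Perm (Fin n)) (i j : Fin n) :
    σ.permMatrix ℝ i j = if σ i = j then 1 else 0 := by
  simp [Equiv.Perm.permMatrix, PEquiv.toMatrix_apply, eq_comm]

theorem permMatrix_pow_mem_permutationPolytope (g : Equiv.Perm (Fin n)) (m : ℕ) :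
    (g ^ m).permMatrix ℝ ∈ permutationPolytope (Subgroup.zpowers g) :=
  subset_convexHull _ _ ⟨_, Subgroup.npow_mem_zpowers g m, rfl⟩

/-- A linear functional constant on the vertices is constant on the dilates. -/
theorem linear_eq_of_mem_smul_permutationPolytope {g : Equiv.Perm (Fin n)}
    {L : Matrix (Fin n) (Fin n) ℝ →ₗ[ℝ] ℝ} {c k : ℝ}
    (h : ∀ m : ℕ, L ((g ^ m).permMatrix ℝ) = c) {M : Matrix (Fin n) (Fin n) ℝ}
    (hM : M ∈ k • permutationPolytope (Subgroup.zpowers g)) : L M = k * c := by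
  obtain ⟨N, hN, rfl⟩ := hM
  have hsub : permutationPolytope (Subgroup.zpowers g) ⊆ {N | L N = c} := by
    refine convexHull_min ?_ (convex_hyperplane L.isLinear c)
    rintro _ ⟨σ, hσ, rfl⟩
    obtain ⟨m, rfl⟩ := (isOfFinOrder_of_finite g).mem_powers_iff_mem_zpowers.2 hσ
    exact h m
  have : L N = c := hsub hN
  simp [this]

theorem nonneg_of_mem_smul_permutationPolytope {G : Subgroup (Equiv.Perm (Fin n))} {k : ℝ}
    (hk : 0 ≤ k) {M : Matrix (Fin n) (Fin n) ℝ} (hM : M ∈ k • permutationPolytope G)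
    (i j : Fin n) : 0 ≤ M i j := by
  obtain ⟨N, hN, rfl⟩ := hM
  have hsub : permutationPolytope G ⊆ {N | 0 ≤ Matrix.entryLinearMap ℝ ℝ i j N} := by
    refine convexHull_min ?_ (convex_halfSpace_ge (LinearMap.isLinear _) 0)
    rintro _ ⟨σ, _, rfl⟩
    simp only [Set.mem_ofPred_eq, Matrix.entryLinearMap_apply, permMatrix_apply_eq_ite]
    split_ifs <;> norm_num
  exact mul_nonneg hk (hsub hN)

variable {g : Equiv.Perm (Fin n)} {k : ℝ} {M : Matrix (Fin n) (Fin n) ℝ}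

/-- Each vertex commutes with `g ^ u`; this is the circulant symmetry. -/
theorem apply_pow_apply_pow_of_mem_smul_permutationPolytope
    (hM : M ∈ k • permutationPolytope (Subgroup.zpowers g)) (u : ℕ) (i j : Fin n) :
    M ((g ^ u) i) ((g ^ u) j) = M i j := by
  have h := linear_eq_of_mem_smul_permutationPolytope (g := g) (c := 0)
    (L := Matrix.entryLinearMap ℝ ℝ ((g ^ u) i) ((g ^ u) j) - Matrix.entryLinearMap ℝ ℝ i j)
    (fun m => by
      have : (g ^ m) ((g ^ u) i) = (g ^ u) ((g ^ m) i) := by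
        rw [← Equiv.Perm.mul_apply, ← Equiv.Perm.mul_apply, ← pow_add, ← pow_add, add_comm]
      simp [this]) hM
  simpa [sub_eq_zero] using h

theorem eq_zero_of_mem_smul_permutationPolytope
    (hM : M ∈ k • permutationPolytope (Subgroup.zpowers g)) {i j : Fin n}
    (hij : ¬ g.SameCycle i j) : M i j = 0 := by
  have h := linear_eq_of_mem_smul_permutationPolytope (g := g) (c := 0)
    (L := Matrix.entryLinearMap ℝ ℝ i j)
    (fun m => by
      have : ¬ (g ^ m) i = j := fun h => hij ⟨m, by simpa using h⟩
      simp [this]) hM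
  simpa using h

theorem diag_of_mem_smul_permutationPolytope
    (hM : M ∈ k • permutationPolytope (Subgroup.zpowers g)) {i : Fin n}
    (hi : g i = i) : M i i = k := by
  have h := linear_eq_of_mem_smul_permutationPolytope (g := g) (c := 1)
    (L := Matrix.entryLinearMap ℝ ℝ i i)
    (fun m => by simp [Equiv.Perm.pow_apply_eq_self_of_apply_eq_self hi])
    hM
  simpa using h

end PermMatrix

/-! ### Entries along a single cycle -/

section Cycle

variable {n q a : ℕ} {g : Equiv.Perm (Fin n)} {C : Finset (Fin n)} {c : Fin n}

theorem permMatrix_pow_apply_pow_of_isCycleOn (hg : g.IsCycleOn (C : Set (Fin n))) (hc : c ∈ C)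
    (hC : C.card = q * a) (m : ℕ) (r : Fin q) (i : Fin a) :
    (g ^ m).permMatrix ℝ c ((g ^ ((r : ℕ) + q * i)) c) =
      if m % q = r ∧ m / q % a = i then 1 else 0 := by
  simp only [permMatrix_apply_eq_ite, hg.pow_apply_eq_pow_apply hc, hC, modEq_add_mul_iff]

/-- The value does not involve `a`, so it is the same for both cycles: this is the source of the
balance condition. -/
theorem sum_permMatrix_pow_apply_pow_of_isCycleOn (hg : g.IsCycleOn (C : Set (Fin n)))
    (hc : c ∈ C) (hC : C.card = q * a) (m : ℕ) (r : Fin q) :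
    ∑ i : Fin a, (g ^ m).permMatrix ℝ c ((g ^ ((r : ℕ) + q * i)) c) =
      if m % q = r then 1 else 0 := by
  have ha : 0 < a := Nat.pos_of_ne_zero fun h => by
    rw [h, mul_zero, Finset.card_eq_zero] at hC
    simp [hC] at hc
  simp only [permMatrix_pow_apply_pow_of_isCycleOn hg hc hC, ite_and]
  split_ifs
  · rw [Finset.sum_eq_single (⟨m / q % a, Nat.mod_lt _ ha⟩ : Fin a)]
    · simp
    · intro i _ hi
      rw [if_neg]
      rintro h
      exact hi (Fin.ext h.symm)
    · simp
  · simp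

theorem exists_eq_pow_apply_of_sameCycle (hg : g.IsCycleOn (C : Set (Fin n)))
    (hc : c ∈ C) (hC : C.card = q * a) {j : Fin n} (hj : j ∈ C) :
    ∃ (r : Fin q) (i : Fin a), (g ^ ((r : ℕ) + q * i)) c = j := by
  obtain ⟨m, hm, rfl⟩ := hg.exists_pow_eq hc hj
  rw [hC] at hm
  have hq : 0 < q := Nat.pos_of_ne_zero fun h => by simp [h] at hm
  refine ⟨⟨m % q, Nat.mod_lt _ hq⟩, ⟨m / q, Nat.div_lt_of_lt_mul hm⟩, ?_⟩
  simp only [Nat.mod_add_div]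

/-- Circulant symmetry moves any entry inside the cycle to row `c`; entries leaving the cycle
vanish. -/
theorem eq_on_cycle_of_mem_smul_permutationPolytope {k : ℝ} {M M' : Matrix (Fin n) (Fin n) ℝ}
    (hM : M ∈ k • permutationPolytope (Subgroup.zpowers g))
    (hM' : M' ∈ k • permutationPolytope (Subgroup.zpowers g))
    (hg : g.IsCycleOn (C : Set (Fin n))) (hc : c ∈ C) (hC : C.card = q * a)
    (h : ∀ (r : Fin q) (i : Fin a),
      M c ((g ^ ((r : ℕ) + q * i)) c) = M' c ((g ^ ((r : ℕ) + q * i)) c))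
    {i j : Fin n} (hi : i ∈ C) : M i j = M' i j := by
  by_cases hj : j ∈ C
  · obtain ⟨u, -, rfl⟩ := hg.exists_pow_eq hc hi
    obtain ⟨v, -, rfl⟩ := hg.exists_pow_eq hi hj
    have hcomm : (g ^ v) ((g ^ u) c) = (g ^ u) ((g ^ v) c) := by
      rw [← Equiv.Perm.mul_apply, ← Equiv.Perm.mul_apply, ← pow_add, ← pow_add, add_comm]
    have hv : (g ^ v) c ∈ C := hg.1.mapsTo.perm_pow v hc
    obtain ⟨r, s, hrs⟩ := exists_eq_pow_apply_of_sameCycle hg hc hC hv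
    rw [hcomm, apply_pow_apply_pow_of_mem_smul_permutationPolytope hM,
      apply_pow_apply_pow_of_mem_smul_permutationPolytope hM', ← hrs, h]
  · have hij : ¬ g.SameCycle i j := by
      rintro ⟨m, rfl⟩
      exact hj ((hg.1.perm_zpow m).mapsTo hi)
    rw [eq_zero_of_mem_smul_permutationPolytope hM hij,
      eq_zero_of_mem_smul_permutationPolytope hM' hij]

end Cycle

theorem cast_floor_of_mem_dilateLatticePoints {n k : ℕ} {G : Subgroup (Equiv.Perm (Fin n))}
    {M : Matrix (Fin n) (Fin n) ℝ} (hM : M ∈ dilateLatticePoints (permutationPolytope G) k)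
    (i j : Fin n) : (⌊M i j⌋₊ : ℝ) = M i j := by
  have h0 := nonneg_of_mem_smul_permutationPolytope k.cast_nonneg hM.1 i j
  obtain ⟨Z, hZ⟩ := hM.2
  have hz : M i j = (Z i j : ℝ) := by rw [← hZ]; rfl
  rw [hz] at h0 ⊢
  lift Z i j to ℕ using (by exact_mod_cast h0) with z
  simp

/-! ### Lattice points and balanced families -/

section TwoCycles

variable {n q a b : ℕ} {g : Equiv.Perm (Fin n)} {C₁ C₂ : Finset (Fin n)} {c₁ c₂ : Fin n}

/-- The entries of a matrix in the rows `c₁` and `c₂`, along the cycles of `g` through these points,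
sorted by residue classes modulo `q`. -/
noncomputable def cycleEntries (g : Equiv.Perm (Fin n)) (c₁ c₂ : Fin n) (q a b : ℕ)
    (M : Matrix (Fin n) (Fin n) ℝ) : Fin q → (Fin a → ℕ) × (Fin b → ℕ) := fun r =>
  (fun i => ⌊M c₁ ((g ^ ((r : ℕ) + q * i)) c₁)⌋₊, fun j => ⌊M c₂ ((g ^ ((r : ℕ) + q * j)) c₂)⌋₊)

theorem mapsTo_cycleEntries (hg₁ : g.IsCycleOn (C₁ : Set (Fin n)))
    (hg₂ : g.IsCycleOn (C₂ : Set (Fin n))) (hc₁ : c₁ ∈ C₁) (hc₂ : c₂ ∈ C₂)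
    (hC₁ : C₁.card = q * a) (hC₂ : C₂.card = q * b) (k : ℕ) :
    Set.MapsTo (cycleEntries g c₁ c₂ q a b)
      (dilateLatticePoints (permutationPolytope (Subgroup.zpowers g)) k)
      (balancedPairs q a b k) := by
  intro M hM
  rw [Finset.mem_coe, mem_balancedPairs]
  have hq : 0 < q := Nat.pos_of_ne_zero fun h => by
    rw [h, zero_mul, Finset.card_eq_zero] at hC₁
    simp [hC₁] at hc₁
  constructor
  · intro r
    -- On `g ^ m` both block sums are the indicator of `m % q = r`, so their difference is zero.
    have h := linear_eq_of_mem_smul_permutationPolytope (g := g) (c := 0)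
      (L := ∑ i : Fin a, Matrix.entryLinearMap ℝ ℝ c₁ ((g ^ ((r : ℕ) + q * i)) c₁) -
        ∑ j : Fin b, Matrix.entryLinearMap ℝ ℝ c₂ ((g ^ ((r : ℕ) + q * j)) c₂))
      (fun m => by
        simp only [LinearMap.sub_apply, LinearMap.sum_apply, Matrix.entryLinearMap_apply,
          sum_permMatrix_pow_apply_pow_of_isCycleOn hg₁ hc₁ hC₁,
          sum_permMatrix_pow_apply_pow_of_isCycleOn hg₂ hc₂ hC₂, sub_self]) hM.1
    simp only [LinearMap.sub_apply, LinearMap.sum_apply, Matrix.entryLinearMap_apply, mul_zero,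
      sub_eq_zero] at h
    rw [← Nat.cast_inj (R := ℝ)]
    simpa [cycleEntries, cast_floor_of_mem_dilateLatticePoints hM] using h
  · have h := linear_eq_of_mem_smul_permutationPolytope (g := g) (c := 1)
      (L := ∑ r : Fin q, ∑ i : Fin a,
        Matrix.entryLinearMap ℝ ℝ c₁ ((g ^ ((r : ℕ) + q * i)) c₁))
      (fun m => by
        simp only [LinearMap.sum_apply, Matrix.entryLinearMap_apply,
          sum_permMatrix_pow_apply_pow_of_isCycleOn hg₁ hc₁ hC₁]
        rw [Finset.sum_eq_single (⟨m % q, Nat.mod_lt _ hq⟩ : Fin q)]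
        · simp
        · intro r _ hr
          exact if_neg fun h => hr (Fin.ext h.symm)
        · simp) hM.1
    simp only [LinearMap.sum_apply, Matrix.entryLinearMap_apply, mul_one] at h
    rw [← Nat.cast_inj (R := ℝ)]
    simpa [cycleEntries, cast_floor_of_mem_dilateLatticePoints hM] using h

theorem injOn_cycleEntries (hg₁ : g.IsCycleOn (C₁ : Set (Fin n)))
    (hg₂ : g.IsCycleOn (C₂ : Set (Fin n))) (hfix : ∀ x, x ∉ C₁ → x ∉ C₂ → g x = x)
    (hc₁ : c₁ ∈ C₁) (hc₂ : c₂ ∈ C₂)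
    (hC₁ : C₁.card = q * a) (hC₂ : C₂.card = q * b) (k : ℕ) :
    Set.InjOn (cycleEntries g c₁ c₂ q a b)
      (dilateLatticePoints (permutationPolytope (Subgroup.zpowers g)) k) := by
  intro M hM M' hM' h
  ext i j
  by_cases hi₁ : i ∈ C₁
  · refine eq_on_cycle_of_mem_smul_permutationPolytope hM.1 hM'.1 hg₁ hc₁ hC₁ (fun r s => ?_) hi₁
    rw [← cast_floor_of_mem_dilateLatticePoints hM, ← cast_floor_of_mem_dilateLatticePoints hM']
    exact congrArg Nat.cast (congrFun (congrArg Prod.fst (congrFun h r)) s)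
  by_cases hi₂ : i ∈ C₂
  · refine eq_on_cycle_of_mem_smul_permutationPolytope hM.1 hM'.1 hg₂ hc₂ hC₂ (fun r s => ?_) hi₂
    rw [← cast_floor_of_mem_dilateLatticePoints hM, ← cast_floor_of_mem_dilateLatticePoints hM']
    exact congrArg Nat.cast (congrFun (congrArg Prod.snd (congrFun h r)) s)
  have hi := hfix i hi₁ hi₂
  by_cases hij : i = j
  · rw [← hij, diag_of_mem_smul_permutationPolytope hM.1 hi,
      diag_of_mem_smul_permutationPolytope hM'.1 hi]
  · have hs : ¬ g.SameCycle i j := by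
      rintro ⟨m, hm⟩
      exact hij ((Equiv.Perm.zpow_apply_eq_self_of_apply_eq_self hi m).symm.trans hm)
    rw [eq_zero_of_mem_smul_permutationPolytope hM.1 hs,
      eq_zero_of_mem_smul_permutationPolytope hM'.1 hs]

/-- A nonzero balanced family is obtained from a smaller one by adding a pair of unit vectors. -/
theorem exists_balancedPairs_of_succ {k : ℕ} {p : Fin q → (Fin a → ℕ) × (Fin b → ℕ)}
    (hp : p ∈ balancedPairs q a b (k + 1)) :
    ∃ p' ∈ balancedPairs q a b k, ∃ (r : Fin q) (i : Fin a) (j : Fin b),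
      (∀ s i', (p s).1 i' = (p' s).1 i' + if r = s ∧ i = i' then 1 else 0) ∧
      ∀ s j', (p s).2 j' = (p' s).2 j' + if r = s ∧ j = j' then 1 else 0 := by
  rw [mem_balancedPairs] at hp
  obtain ⟨hbal, hsum⟩ := hp
  obtain ⟨r, -, hr⟩ := Finset.exists_ne_zero_of_sum_ne_zero (hsum.trans_ne k.succ_ne_zero)
  obtain ⟨i, -, hi⟩ := Finset.exists_ne_zero_of_sum_ne_zero hr
  rw [hbal r] at hr
  obtain ⟨j, -, hj⟩ := Finset.exists_ne_zero_of_sum_ne_zero hr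
  have h₁ : ∀ s i', (p s).1 i' =
      ((p s).1 i' - if r = s ∧ i = i' then 1 else 0) + if r = s ∧ i = i' then 1 else 0 := by
    intro s i'
    split_ifs with h
    · obtain ⟨rfl, rfl⟩ := h
      omega
    · rfl
  have h₂ : ∀ s j', (p s).2 j' =
      ((p s).2 j' - if r = s ∧ j = j' then 1 else 0) + if r = s ∧ j = j' then 1 else 0 := by
    intro s j'
    split_ifs with h
    · obtain ⟨rfl, rfl⟩ := h
      omega
    · rfl
  refine ⟨fun s => (fun i' => (p s).1 i' - if r = s ∧ i = i' then 1 else 0,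
    fun j' => (p s).2 j' - if r = s ∧ j = j' then 1 else 0), ?_, r, i, j, h₁, h₂⟩
  have hs₁ : ∀ s, ∑ i', (p s).1 i' =
      ∑ i', ((p s).1 i' - if r = s ∧ i = i' then 1 else 0) + if r = s then 1 else 0 := by
    intro s
    rw [Finset.sum_congr rfl fun i' _ => h₁ s i', Finset.sum_add_distrib]
    simp [ite_and]
  have hs₂ : ∀ s, ∑ j', (p s).2 j' =
      ∑ j', ((p s).2 j' - if r = s ∧ j = j' then 1 else 0) + if r = s then 1 else 0 := by
    intro s
    rw [Finset.sum_congr rfl fun j' _ => h₂ s j', Finset.sum_add_distrib]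
    simp [ite_and]
  rw [mem_balancedPairs]
  constructor
  · intro s
    have := hbal s
    rw [hs₁, hs₂] at this
    exact Nat.add_right_cancel this
  · rw [Finset.sum_congr rfl fun s _ => hs₁ s, Finset.sum_add_distrib] at hsum
    simpa using hsum

/-- Peeling off one pair of unit vectors at a time writes the family as a sum of `k` vertices. -/
theorem exists_mem_dilateLatticePoints (hg₁ : g.IsCycleOn (C₁ : Set (Fin n)))
    (hg₂ : g.IsCycleOn (C₂ : Set (Fin n))) (hc₁ : c₁ ∈ C₁) (hc₂ : c₂ ∈ C₂)
    (hC₁ : C₁.card = q * a) (hC₂ : C₂.card = q * b) (hab : Nat.gcd (q * a) (q * b) = q) (k : ℕ)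
    (p : Fin q → (Fin a → ℕ) × (Fin b → ℕ)) (hp : p ∈ balancedPairs q a b k) :
    ∃ M ∈ dilateLatticePoints (permutationPolytope (Subgroup.zpowers g)) k,
      (∀ (r : Fin q) (i : Fin a), M c₁ ((g ^ ((r : ℕ) + q * i)) c₁) = (p r).1 i) ∧
      ∀ (r : Fin q) (j : Fin b), M c₂ ((g ^ ((r : ℕ) + q * j)) c₂) = (p r).2 j := by
  induction k generalizing p with
  | zero =>
    obtain ⟨hbal, hsum⟩ := mem_balancedPairs.1 hp
    have h : ∀ r, ∑ i, (p r).1 i = 0 := by simpa using hsum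
    refine ⟨0, ⟨?_, 0, ?_⟩, ?_, ?_⟩
    · rw [Nat.cast_zero]
      exact ⟨_, permMatrix_pow_mem_permutationPolytope g 0, zero_smul _ _⟩
    · ext; simp
    · intro r i
      have := h r
      rw [Finset.sum_eq_zero_iff] at this
      simp [this i]
    · intro r j
      have := (hbal r).symm.trans (h r)
      rw [Finset.sum_eq_zero_iff] at this
      simp [this j]
  | succ k ih =>
    obtain ⟨p', hp', r, i, j, h₁, h₂⟩ := exists_balancedPairs_of_succ hp
    obtain ⟨M, ⟨hM, Z, hZ⟩, hM₁, hM₂⟩ := ih p' hp'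
    -- This single `g ^ m` realises the removed pair: position `(r, i)` on the first cycle and `(r,
    -- j)` on the second.
    obtain ⟨m, hm₁, hm₂⟩ := exists_modEq_add_mul hab r i j
    rw [modEq_add_mul_iff] at hm₁ hm₂
    refine ⟨M + (g ^ m).permMatrix ℝ, ⟨?_, Z + (g ^ m).permMatrix ℤ, ?_⟩, ?_, ?_⟩
    -- Convexity gives `(k + 1)P = kP + P`.
    · rw [Nat.cast_succ, permutationPolytope, (convex_convexHull ℝ _).add_smul k.cast_nonneg zero_le_one, one_smul]
      exact Set.add_mem_add hM (permMatrix_pow_mem_permutationPolytope g m)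
    · rw [← hZ]
      ext u v
      simp [Equiv.Perm.permMatrix, PEquiv.toMatrix_apply]
    · intro s i'
      rw [Matrix.add_apply, hM₁, permMatrix_pow_apply_pow_of_isCycleOn hg₁ hc₁ hC₁, hm₁.1, hm₁.2,
        h₁]
      simp [Fin.ext_iff]
    · intro s j'
      rw [Matrix.add_apply, hM₂, permMatrix_pow_apply_pow_of_isCycleOn hg₂ hc₂ hC₂, hm₂.1, hm₂.2,
        h₂]
      simp [Fin.ext_iff]

theorem bijOn_cycleEntries (hg₁ : g.IsCycleOn (C₁ : Set (Fin n)))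
    (hg₂ : g.IsCycleOn (C₂ : Set (Fin n))) (hfix : ∀ x, x ∉ C₁ → x ∉ C₂ → g x = x)
    (hc₁ : c₁ ∈ C₁) (hc₂ : c₂ ∈ C₂)
    (hC₁ : C₁.card = q * a) (hC₂ : C₂.card = q * b) (hab : Nat.gcd (q * a) (q * b) = q) (k : ℕ) :
    Set.BijOn (cycleEntries g c₁ c₂ q a b)
      (dilateLatticePoints (permutationPolytope (Subgroup.zpowers g)) k)
      (balancedPairs q a b k) := by
  refine ⟨mapsTo_cycleEntries hg₁ hg₂ hc₁ hc₂ hC₁ hC₂ k,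
    injOn_cycleEntries hg₁ hg₂ hfix hc₁ hc₂ hC₁ hC₂ k, fun p hp => ?_⟩
  obtain ⟨M, hM, h₁, h₂⟩ := exists_mem_dilateLatticePoints hg₁ hg₂ hc₁ hc₂ hC₁ hC₂ hab k p hp
  refine ⟨M, hM, ?_⟩
  funext r
  simp [cycleEntries, h₁, h₂]

end TwoCycles

/-! ### The Ehrhart series -/

theorem mk_choose_mul_choose_eq_sum (A B : ℕ) :
    (PowerSeries.mk fun i => (A.choose i * B.choose i : ℚ)) =
      ∑ i ∈ Finset.range (min A B + 1),
        ((A.choose i * B.choose i : ℕ) : ℚ⟦X⟧) * PowerSeries.X ^ i := by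
  ext k
  have hC : ∀ m : ℕ, (m : ℚ⟦X⟧) = PowerSeries.C (m : ℚ) := fun m => by simp
  simp only [map_sum, hC, PowerSeries.coeff_C_mul, PowerSeries.coeff_X_pow, mul_ite, mul_one,
    mul_zero, PowerSeries.coeff_mk, Finset.sum_ite_eq, Finset.mem_range, Nat.cast_mul]
  split_ifs with h
  · rfl
  · rcases min_lt_iff.1 (show min A B < k by omega) with h | h <;>
      simp [Nat.choose_eq_zero_of_lt h]

theorem mainTheorem3 (n : ℕ) (g : Equiv.Perm (Fin n)) (C₁ C₂ : Finset (Fin n))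
    (hC₁ : C₁.Nonempty) (hC₂ : C₂.Nonempty) (hdisj : Disjoint C₁ C₂)
    (hg₁ : g.IsCycleOn (C₁ : Set (Fin n))) (hg₂ : g.IsCycleOn (C₂ : Set (Fin n)))
    (hfix : ∀ x, x ∉ C₁ → x ∉ C₂ → g x = x)
    (ℓ₁ ℓ₂ q : ℕ) (hℓ₁ : C₁.card = ℓ₁) (hℓ₂ : C₂.card = ℓ₂) (hq : q = Nat.gcd ℓ₁ ℓ₂) :
    (∀ k : ℕ, (dilateLatticePoints (permutationPolytope (Subgroup.zpowers g)) k).Finite) ∧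
    ehrhartSeries (permutationPolytope (Subgroup.zpowers g)) =
      (∑ i ∈ Finset.range (min (ℓ₁ / q - 1) (ℓ₂ / q - 1) + 1),
        (((ℓ₁ / q - 1).choose i * (ℓ₂ / q - 1).choose i : ℕ) : ℚ⟦X⟧) * PowerSeries.X ^ i) ^ q
      * ((1 - PowerSeries.X : ℚ⟦X⟧) ^ (ℓ₁ + ℓ₂ - q))⁻¹ := by
  obtain ⟨c₁, hc₁⟩ := hC₁
  obtain ⟨c₂, hc₂⟩ := hC₂
  have hpos₁ : 0 < ℓ₁ := hℓ₁ ▸ Finset.card_pos.2 ⟨c₁, hc₁⟩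
  have hpos₂ : 0 < ℓ₂ := hℓ₂ ▸ Finset.card_pos.2 ⟨c₂, hc₂⟩
  have hqpos : 0 < q := hq ▸ Nat.gcd_pos_of_pos_left _ hpos₁
  obtain ⟨a, ha⟩ : q ∣ ℓ₁ := hq ▸ Nat.gcd_dvd_left _ _
  obtain ⟨b, hb⟩ : q ∣ ℓ₂ := hq ▸ Nat.gcd_dvd_right _ _
  obtain ⟨A, rfl⟩ : ∃ A, a = A + 1 :=
    Nat.exists_eq_succ_of_ne_zero fun h => by simp [h] at ha; omega
  obtain ⟨B, rfl⟩ : ∃ B, b = B + 1 :=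
    Nat.exists_eq_succ_of_ne_zero fun h => by simp [h] at hb; omega
  have hab : Nat.gcd (q * (A + 1)) (q * (B + 1)) = q := by rw [← ha, ← hb, ← hq]
  have hbij := bijOn_cycleEntries hg₁ hg₂ hfix hc₁ hc₂ (hℓ₁.trans ha) (hℓ₂.trans hb) hab
  refine ⟨fun k => Set.Finite.of_injOn (hbij k).mapsTo (hbij k).injOn (Finset.finite_toSet _), ?_⟩
  have hseries : ehrhartSeries (permutationPolytope (Subgroup.zpowers g)) =
      (PowerSeries.mk fun s => ((A + s).choose A * (B + s).choose B : ℚ)) ^ q := by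
    ext k
    rw [ehrhartSeries, PowerSeries.coeff_mk, (hbij k).ncard_eq, Set.ncard_coe_finset,
      card_balancedPairs]
  -- Each of the `q` factors carries the denominator `(1 - X) ^ (A + B + 1)`.
  have hexp : ℓ₁ + ℓ₂ - q = (A + B + 1) * q := by
    rw [ha, hb]
    apply Nat.sub_eq_of_eq_add
    ring
  rw [ha, hb, Nat.mul_div_cancel_left _ hqpos, Nat.mul_div_cancel_left _ hqpos, ← ha, ← hb, hexp,
    Nat.add_sub_cancel, Nat.add_sub_cancel, ← mk_choose_mul_choose_eq_sum,
    PowerSeries.eq_mul_inv_iff_mul_eq (by simp), hseries, pow_mul, ← mul_pow,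
    mk_choose_mul_choose_mul_one_sub_X_pow]
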